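/- Let $n\ge 1$ be an integer and $\mathcal Y$ a complex Hilbert space. For a complex Hilbert space $\mathcal E$ let $\mathcal A_n(\mathcal E)$ be the Hilbert space of $\mathcal E$-valued analytic functions $f(z)=\sum_{j\ge 0}f_jz^j$ on the open unit disk $\mathbb D$ with $$\|f\|_{\mathcal A_n(\mathcal E)}^2=\sum_{j\ge 0}\mu_{n,j}\|f_j\|_{\mathcal E}^2<\infty,\qquad \mu_{n,j}=\binom{j+n-1}{j}^{-1},$$ and let $S_n$ be the operator $f(z)\mapsto zf(z)$ on it. A bounded operator $A$ on a Hilbert space $\mathcal X$ is an $n$-hypercontraction if $\sum_{j=0}^{k}(-1)^j\binom kj A^{*j}A^j\ge 0$ for all $0\le k\le n$, and is strongly stable if $\|A^kx\|\to 0$ as $k\to\infty$ for every $x\in\mathcal X$. A function $\Theta$ on $\mathbb D$ with values in the bounded operators $\mathcal L(\mathcal U,\mathcal Y)$ is a contractive multiplier if $M_\Theta\colon f(z)\mapsto\Theta(z)f(z)$ is a contraction from $\mathcal A_n(\mathcal U)$ into $\mathcal A_n(\mathcal Y)$. Theorem. Let $\mathcal M$ be a complex Hilbert space whose elements are $\mathcal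 Y$-valued functions on $\mathbb D$, with the pointwise vector space operations. Then the three conditions 1. $\mathcal M$ is contractively included in $\mathcal A_n(\mathcal Y)$, i.e. $\mathcal M\subset\mathcal A_n(\mathcal Y)$ and $\|f\|_{\mathcal A_n(\mathcal Y)}\le\|f\|_{\mathcal M}$ for all $f\in\mathcal M$; 2. $\mathcal M$ is $S_n$-invariant: $S_n\mathcal M\subset\mathcal M$; 3. the operator $A=(S_n|_{\mathcal M})^*$ (adjoint taken in $\mathcal M$) is a strongly stable $n$-hypercontraction on $\mathcal M$ all hold if and only if there are a complex Hilbert space $\mathcal U$ and a contractive multiplier $\Theta$ with values in $\mathcal L(\mathcal U,\mathcal Y)$ such that $\mathcal M=\Theta\cdot\mathcal A_n(\mathcal U)$ with the lifted norm $$\|\Theta\cdot f\|_{\mathcal M}=\|Qf\|_{\mathcal A_n(\mathcal U)}\qquad(f\in\mathcal A_n(\mathcal U)),$$ where $Q$ is the orthogonal projection of $\mathcal A_n(\mathcal U)$ onto $(\operatorname{Ker}M_\Theta)^\perp$. -/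

import Mathlib

open scoped Complex.UnitDisc Topology

universe u v

noncomputable section

/-! ### The weights `μ_{n,j} = j! (n-1)! / (j+n-1)!`  (used only for `1 ≤ n`) -/

/-- The weight `μ_{n,j} = j! (n-1)! / (j+n-1)!`. -/
def bergmanWeight (n j : ℕ) : ℝ :=
  ((j.factorial : ℝ) * ((n - 1).factorial : ℝ)) / ((j + n - 1).factorial : ℝ)

/-- For `n ≥ 1` the weight is the inverse binomial coefficient. -/
theorem bergmanWeight_eq {n : ℕ} (hn : 1 ≤ n) (j : ℕ) :
    bergmanWeight n j = 1 / ((j + n - 1).choose j : ℝ) := by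
  unfold bergmanWeight
  rw [Nat.cast_choose ℝ (show j ≤ j + n - 1 by omega), one_div_div,
    show j + n - 1 - j = n - 1 by omega]

theorem bergmanWeight_pos (n j : ℕ) : 0 < bergmanWeight n j := by
  unfold bergmanWeight; positivity

theorem bergmanWeight_succ_le (n j : ℕ) :
    bergmanWeight n (j + 1) ≤ 2 * bergmanWeight n j := by
  unfold bergmanWeight
  rw [← mul_div_assoc, div_le_div_iff₀ (by positivity) (by positivity)]
  have key : (j + 1) * (j + n - 1).factorial ≤ 2 * (j + 1 + n - 1).factorial := by
    rcases Nat.eq_zero_or_pos n with rfl | hn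
    · rcases j with _ | j
      · simp
      · simp only [add_zero, Nat.add_sub_cancel, Nat.factorial_succ]
        nlinarith [Nat.factorial_pos j, Nat.zero_le (j * j.factorial)]
    · rw [show j + 1 + n - 1 = (j + n - 1) + 1 by omega, Nat.factorial_succ]
      nlinarith [Nat.factorial_pos (j + n - 1),
        Nat.mul_le_mul_right (j + n - 1).factorial (show j + 1 ≤ j + n - 1 + 1 by omega)]
  have key' : ((j : ℝ) + 1) * (j + n - 1).factorial ≤ 2 * (j + 1 + n - 1).factorial := by
    exact_mod_cast key
  rw [Nat.factorial_succ]
  push_cast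
  have h0 : (0 : ℝ) ≤ (j.factorial : ℝ) * (n - 1).factorial := by positivity
  nlinarith [mul_le_mul_of_nonneg_left key' h0]

theorem inv_bergmanWeight_le (n j : ℕ) :
    (bergmanWeight n j)⁻¹ ≤ ((j + n).choose n : ℝ) := by
  have h1 : (1 : ℝ) ≤ ((j + n).choose n : ℝ) := by
    exact_mod_cast Nat.choose_pos (by omega)
  rcases Nat.eq_zero_or_pos n with rfl | hn
  · refine le_trans ?_ h1
    unfold bergmanWeight
    rw [inv_div, div_le_one (by positivity)]
    simp only [add_zero, Nat.zero_sub, Nat.factorial_zero, Nat.cast_one, mul_one]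
    exact_mod_cast Nat.factorial_le (Nat.sub_le j 1)
  · rw [bergmanWeight_eq hn, one_div, inv_inv]
    have : (j + n - 1).choose j ≤ (j + n).choose n := by
      rw [show (j + n).choose n = (j + n).choose j from (Nat.choose_symm_add).symm]
      exact Nat.choose_le_choose j (by omega)
    exact_mod_cast this

section Space

variable (n : ℕ) {Y : Type*} [NormedAddCommGroup Y] [InnerProductSpace ℂ Y]

/-- A power series converging to zero on the disk has vanishing coefficients. -/
theorem powerSeries_coeff_eq_zero {a : ℕ → Y}
    (h : ∀ z : 𝔻, HasSum (fun j => (z : ℂ) ^ j • a j) 0) : a = 0 := by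
  let p : FormalMultilinearSeries ℂ ℂ Y :=
    fun j => ContinuousMultilinearMap.mkPiRing ℂ (Fin j) (a j)
  have hp : HasFPowerSeriesAt (0 : ℂ → Y) p 0 := by
    rw [hasFPowerSeriesAt_iff]
    filter_upwards [Metric.ball_mem_nhds (0 : ℂ) one_pos] with z hz
    have := h (Complex.UnitDisc.mk z (by simpa using hz))
    simpa [p, FormalMultilinearSeries.coeff] using this
  have h0 := hp.eq_zero
  funext j
  have := congrArg (fun p => p.coeff j) h0
  simpa [p, FormalMultilinearSeries.coeff] using this

theorem powerSeries_coeff_unique {a b : ℕ → Y} {f : 𝔻 → Y}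
    (ha : ∀ z : 𝔻, HasSum (fun j => (z : ℂ) ^ j • a j) (f z))
    (hb : ∀ z : 𝔻, HasSum (fun j => (z : ℂ) ^ j • b j) (f z)) : a = b := by
  have : a - b = 0 := powerSeries_coeff_eq_zero fun z => by
    simpa [smul_sub] using (ha z).sub (hb z)
  exact sub_eq_zero.mp this

variable (Y)

/-- The linear space of `Y`-valued functions `f(z) = ∑ f_j z^j` on the open unit disk with
`∑ μ_{n,j} ‖f_j‖² < ∞`. -/
def bergmanSubmodule : Submodule ℂ (𝔻 → Y) where
  carrier := {f | ∃ a : ℕ → Y, Summable (fun j => bergmanWeight n j * ‖a j‖ ^ 2) ∧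
    ∀ z : 𝔻, HasSum (fun j => (z : ℂ) ^ j • a j) (f z)}
  zero_mem' := ⟨0, by simp, fun z => by simp⟩
  add_mem' := by
    rintro f g ⟨a, ha, hfa⟩ ⟨b, hb, hgb⟩
    refine ⟨a + b, ?_, fun z => by simpa [smul_add] using (hfa z).add (hgb z)⟩
    refine Summable.of_nonneg_of_le
      (fun j => mul_nonneg (bergmanWeight_pos n j).le (sq_nonneg _)) (fun j => ?_)
      ((ha.add hb).mul_left 2)
    have h1 : ‖a j + b j‖ ^ 2 ≤ 2 * (‖a j‖ ^ 2 + ‖b j‖ ^ 2) := by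
      nlinarith [norm_add_le (a j) (b j), norm_nonneg (a j + b j),
        sq_nonneg (‖a j‖ - ‖b j‖)]
    have := mul_le_mul_of_nonneg_left h1 (bergmanWeight_pos n j).le
    simp only [Pi.add_apply]
    linarith
  smul_mem' := by
    rintro c f ⟨a, ha, hfa⟩
    refine ⟨c • a, ?_, fun z => ?_⟩
    · refine (ha.mul_left (‖c‖ ^ 2)).congr fun j => ?_
      simp only [Pi.smul_apply, norm_smul]; ring
    · simpa [smul_comm c] using (hfa z).const_smul c

/-- The weighted Bergman space `A_n(Y)`. This is a separate type, so that it carries the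
Bergman norm and not the topology of pointwise convergence. -/
def BergmanSpace : Type _ := ↥(bergmanSubmodule n Y)

namespace BergmanSpace

instance : AddCommGroup (BergmanSpace n Y) :=
  inferInstanceAs (AddCommGroup ↥(bergmanSubmodule n Y))

instance : Module ℂ (BergmanSpace n Y) :=
  inferInstanceAs (Module ℂ ↥(bergmanSubmodule n Y))

instance : FunLike (BergmanSpace n Y) 𝔻 Y where
  coe f := f.1
  coe_injective _ _ h := Subtype.ext h

variable {n Y}

@[ext] theorem ext {f g : BergmanSpace n Y} (h : ∀ z, f z = g z) : f = g :=
  DFunLike.ext _ _ h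

@[simp] theorem add_apply (f g : BergmanSpace n Y) (z : 𝔻) : (f + g) z = f z + g z := rfl
@[simp] theorem smul_apply (c : ℂ) (f : BergmanSpace n Y) (z : 𝔻) : (c • f) z = c • f z := rfl
@[simp] theorem zero_apply (z : 𝔻) : (0 : BergmanSpace n Y) z = 0 := rfl

/-- The Taylor coefficients `f_j` of `f(z) = ∑ f_j z^j`. -/
def coeff (f : BergmanSpace n Y) : ℕ → Y := f.2.choose

theorem summable_coeff (f : BergmanSpace n Y) :
    Summable (fun j => bergmanWeight n j * ‖coeff f j‖ ^ 2) := f.2.choose_spec.1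

theorem hasSum_coeff (f : BergmanSpace n Y) (z : 𝔻) :
    HasSum (fun j => (z : ℂ) ^ j • coeff f j) (f z) := f.2.choose_spec.2 z

theorem coeff_eq {f : BergmanSpace n Y} {a : ℕ → Y}
    (h : ∀ z : 𝔻, HasSum (fun j => (z : ℂ) ^ j • a j) (f z)) : coeff f = a :=
  powerSeries_coeff_unique (hasSum_coeff f) h

/-- The function in `A_n(Y)` with given Taylor coefficients. -/
theorem exists_of_summable {a : ℕ → Y} [CompleteSpace Y]
    (ha : Summable (fun j => bergmanWeight n j * ‖a j‖ ^ 2)) :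
    ∃ f : BergmanSpace n Y, coeff f = a := by
  have hs : ∀ z : 𝔻, Summable (fun j => (z : ℂ) ^ j • a j) := fun z => by
    have hz : ‖(‖(z : ℂ)‖ ^ 2 : ℝ)‖ < 1 := by
      rw [norm_pow, norm_norm]; exact z.sq_norm_lt_one
    refine Summable.of_norm_bounded
      ((summable_choose_mul_geometric_of_norm_lt_one n hz).add ha) fun j => ?_
    have hw := bergmanWeight_pos n j
    have h1 : ‖(z : ℂ)‖ ^ j * ‖a j‖ ≤
        (bergmanWeight n j)⁻¹ * (‖(z : ℂ)‖ ^ 2) ^ j + bergmanWeight n j * ‖a j‖ ^ 2 := by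
      have e : (‖(z : ℂ)‖ ^ 2) ^ j = (‖(z : ℂ)‖ ^ j) ^ 2 := by
        rw [← pow_mul, ← pow_mul, mul_comm]
      rw [e]
      set p := ‖(z : ℂ)‖ ^ j
      set q := ‖a j‖
      set w := bergmanWeight n j
      have hp : 0 ≤ p := by positivity
      have hq : 0 ≤ q := norm_nonneg _
      have h2 : 0 ≤ w⁻¹ * (p - w * q) ^ 2 := by positivity
      have h3 : w⁻¹ * (p - w * q) ^ 2 = w⁻¹ * p ^ 2 + w * q ^ 2 - 2 * (p * q) := by
        field_simp
        ring
      nlinarith [mul_nonneg hp hq]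
    rw [norm_smul, norm_pow]
    refine h1.trans ?_
    gcongr
    exact inv_bergmanWeight_le n j
  let f : BergmanSpace n Y := ⟨fun z => ∑' j, (z : ℂ) ^ j • a j, a, ha, fun z => (hs z).hasSum⟩
  exact ⟨f, coeff_eq fun z => (hs z).hasSum⟩

theorem coeff_add (f g : BergmanSpace n Y) : coeff (f + g) = coeff f + coeff g :=
  coeff_eq fun z => by
    simpa [smul_add] using (hasSum_coeff f z).add (hasSum_coeff g z)

theorem coeff_smul (c : ℂ) (f : BergmanSpace n Y) : coeff (c • f) = c • coeff f :=
  coeff_eq fun z => by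
    simpa [smul_comm c] using (hasSum_coeff f z).const_smul c

/-- The linear map `f ↦ (√μ_{n,j} f_j)_j` into the unweighted `ℓ²(Y)`. -/
def toSeq : BergmanSpace n Y →ₗ[ℂ] lp (fun _ : ℕ => Y) 2 where
  toFun f := ⟨fun j => (√(bergmanWeight n j) : ℂ) • coeff f j, by
    refine (memℓp_gen_iff (p := 2) (by norm_num)).2 ?_
    refine (summable_coeff f).congr fun j => ?_
    simp [norm_smul, mul_pow, abs_of_nonneg (Real.sqrt_nonneg _),
      Real.sq_sqrt (bergmanWeight_pos n j).le]⟩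
  map_add' f g := by
    ext j
    exact (congrArg _ (congrFun (coeff_add f g) j)).trans (smul_add _ _ _)
  map_smul' c f := by
    ext j
    exact (congrArg _ (congrFun (coeff_smul c f) j)).trans (smul_comm _ _ _)

theorem toSeq_apply (f : BergmanSpace n Y) (j : ℕ) :
    toSeq f j = (√(bergmanWeight n j) : ℂ) • coeff f j := rfl

theorem sqrt_weight_ne_zero (j : ℕ) : ((√(bergmanWeight n j) : ℝ) : ℂ) ≠ 0 := by
  exact_mod_cast (Real.sqrt_pos.mpr (bergmanWeight_pos n j)).ne'

theorem toSeq_injective : Function.Injective (toSeq : BergmanSpace n Y → _) := by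
  intro f g h
  have hc : coeff f = coeff g := by
    funext j
    have := congrArg (fun s : lp (fun _ : ℕ => Y) 2 => s j) h
    simp only [toSeq_apply] at this
    exact smul_right_injective Y (sqrt_weight_ne_zero j) this
  ext z
  exact (hasSum_coeff f z).unique (hc ▸ hasSum_coeff g z)

theorem toSeq_surjective [CompleteSpace Y] :
    Function.Surjective (toSeq : BergmanSpace n Y → _) := by
  intro s
  have hs := (memℓp_gen_iff (p := 2) (by norm_num)).1 s.2
  obtain ⟨f, hf⟩ := exists_of_summable (n := n)
    (a := fun j => ((√(bergmanWeight n j) : ℝ) : ℂ)⁻¹ • s j) (by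
      refine hs.congr fun j => ?_
      have hw := bergmanWeight_pos n j
      simp only [ENNReal.toReal_ofNat, Real.rpow_ofNat, norm_smul, norm_inv, Complex.norm_real,
        Real.norm_eq_abs, abs_of_nonneg (Real.sqrt_nonneg _), mul_pow, inv_pow,
        Real.sq_sqrt hw.le]
      field_simp)
  refine ⟨f, ?_⟩
  ext j
  rw [toSeq_apply, hf, smul_smul, mul_inv_cancel₀ (sqrt_weight_ne_zero j), one_smul]

/-- The inner product `⟪f, g⟫ = ∑ μ_{n,j} ⟪f_j, g_j⟫`. -/
instance : Inner ℂ (BergmanSpace n Y) where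
  inner f g := ∑' j, (bergmanWeight n j : ℂ) * inner ℂ (coeff f j) (coeff g j)

theorem inner_def (f g : BergmanSpace n Y) :
    inner ℂ f g = ∑' j, (bergmanWeight n j : ℂ) * inner ℂ (coeff f j) (coeff g j) := rfl

theorem inner_eq_toSeq (f g : BergmanSpace n Y) :
    inner ℂ f g = inner ℂ (toSeq f) (toSeq g) := by
  rw [inner_def, lp.inner_eq_tsum]
  refine tsum_congr fun j => ?_
  rw [toSeq_apply, toSeq_apply, inner_smul_left, inner_smul_right, ← mul_assoc,
    Complex.conj_ofReal, ← Complex.ofReal_mul, Real.mul_self_sqrt (bergmanWeight_pos n j).le]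

variable (n Y) in
/-- The inner product axioms. -/
@[reducible] def core : InnerProductSpace.Core ℂ (BergmanSpace n Y) where
  conj_inner_symm f g := by simp only [inner_eq_toSeq]; exact inner_conj_symm _ _
  re_inner_nonneg f := by simp only [inner_eq_toSeq]; exact inner_self_nonneg
  add_left f g h := by simp only [inner_eq_toSeq, map_add, inner_add_left]
  smul_left f g c := by simp only [inner_eq_toSeq, map_smul, inner_smul_left]
  definite f h := by
    rw [inner_eq_toSeq, inner_self_eq_zero] at h
    exact toSeq_injective (h.trans (map_zero _).symm)

/-- The Bergman norm is the one given by the inner product. -/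
instance : NormedAddCommGroup (BergmanSpace n Y) := (core n Y).toNormedAddCommGroup

instance : InnerProductSpace ℂ (BergmanSpace n Y) := InnerProductSpace.ofCore (core n Y).toCore

theorem norm_toSeq (f : BergmanSpace n Y) : ‖toSeq f‖ = ‖f‖ := by
  rw [← sq_eq_sq₀ (norm_nonneg _) (norm_nonneg _), norm_sq_eq_re_inner (𝕜 := ℂ),
    norm_sq_eq_re_inner (𝕜 := ℂ) f]
  exact congrArg RCLike.re (inner_eq_toSeq f f).symm

/-- `‖f‖² = ∑ μ_{n,j} ‖f_j‖²`. -/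
theorem norm_sq_eq (f : BergmanSpace n Y) :
    ‖f‖ ^ 2 = ∑' j, bergmanWeight n j * ‖coeff f j‖ ^ 2 := by
  rw [← norm_toSeq, ← Real.rpow_natCast]
  have := lp.norm_rpow_eq_tsum (p := 2) (by norm_num) (toSeq f)
  simp only [ENNReal.toReal_ofNat] at this
  rw [Nat.cast_ofNat, this]
  refine tsum_congr fun j => ?_
  rw [toSeq_apply, norm_smul]
  simp [mul_pow, abs_of_nonneg (Real.sqrt_nonneg _), Real.sq_sqrt (bergmanWeight_pos n j).le]

/-- The identification of `A_n(Y)` with `ℓ²(Y)`. -/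
def equivSeq [CompleteSpace Y] : BergmanSpace n Y ≃ₗᵢ[ℂ] lp (fun _ : ℕ => Y) 2 where
  toLinearEquiv := LinearEquiv.ofBijective toSeq ⟨toSeq_injective, toSeq_surjective⟩
  norm_map' := norm_toSeq

instance [CompleteSpace Y] : CompleteSpace (BergmanSpace n Y) :=
  (equivSeq (n := n) (Y := Y)).toIsometryEquiv.completeSpace

/-- Multiplication by the coordinate function preserves `A_n(Y)`. -/
theorem exists_shift (f : BergmanSpace n Y) :
    ∃ g : BergmanSpace n Y, (∀ z : 𝔻, g z = (z : ℂ) • f z) ∧ ‖g‖ ≤ √2 * ‖f‖ := by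
  let a : ℕ → Y := fun j => Nat.casesOn j 0 (coeff f)
  have hle : ∀ j, bergmanWeight n (j + 1) * ‖coeff f j‖ ^ 2 ≤
      2 * (bergmanWeight n j * ‖coeff f j‖ ^ 2) := fun j => by
    rw [← mul_assoc]
    exact mul_le_mul_of_nonneg_right (bergmanWeight_succ_le n j) (sq_nonneg _)
  have hs' : Summable (fun j => bergmanWeight n (j + 1) * ‖coeff f j‖ ^ 2) :=
    Summable.of_nonneg_of_le (fun j => mul_nonneg (bergmanWeight_pos n _).le (sq_nonneg _)) hle
      ((summable_coeff f).mul_left 2)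
  have hs : Summable (fun j => bergmanWeight n j * ‖a j‖ ^ 2) := (summable_nat_add_iff 1).1 hs'
  have hz : ∀ z : 𝔻, HasSum (fun j => (z : ℂ) ^ j • a j) ((z : ℂ) • f z) := fun z => by
    rw [← hasSum_nat_add_iff' 1]
    simpa [a, pow_succ', smul_smul] using (hasSum_coeff f z).const_smul (z : ℂ)
  let g : BergmanSpace n Y := ⟨fun z => (z : ℂ) • f z, a, hs, hz⟩
  have hg : coeff g = a := coeff_eq hz
  refine ⟨g, fun z => rfl, ?_⟩
  refine abs_le_of_sq_le_sq' ?_ (by positivity) |>.2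
  rw [mul_pow, Real.sq_sqrt zero_le_two, norm_sq_eq, norm_sq_eq, hg, ← tsum_mul_left,
    hs.tsum_eq_zero_add]
  simpa [a] using hs'.tsum_le_tsum hle ((summable_coeff f).mul_left 2)

end BergmanSpace

/-- The Bergman shift `S_n : f(z) ↦ z f(z)` on `A_n(Y)`. -/
def bergmanShift : BergmanSpace n Y →L[ℂ] BergmanSpace n Y :=
  LinearMap.mkContinuous
    { toFun := fun f => (BergmanSpace.exists_shift f).choose
      map_add' := fun f g => by
        ext z
        rw [BergmanSpace.add_apply, (BergmanSpace.exists_shift (f + g)).choose_spec.1,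
          (BergmanSpace.exists_shift f).choose_spec.1, (BergmanSpace.exists_shift g).choose_spec.1]
        simp
      map_smul' := fun c f => by
        ext z
        rw [BergmanSpace.smul_apply, (BergmanSpace.exists_shift (c • f)).choose_spec.1,
          (BergmanSpace.exists_shift f).choose_spec.1]
        simp [smul_comm c] }
    (√2) (fun f => (BergmanSpace.exists_shift f).choose_spec.2)

theorem bergmanShift_apply (f : BergmanSpace n Y) (z : 𝔻) :
    bergmanShift n Y f z = (z : ℂ) • f z :=
  (BergmanSpace.exists_shift f).choose_spec.1 z

end Space

/-! ### Contractive multipliers -/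

section Multiplier

variable (n : ℕ) {U Y : Type*} [NormedAddCommGroup U] [InnerProductSpace ℂ U]
  [NormedAddCommGroup Y] [InnerProductSpace ℂ Y]

/-- An `L(U,Y)`-valued function `Θ` on the disk is a contractive multiplier if `f ↦ Θ · f`
maps `A_n(U)` contractively into `A_n(Y)`. -/
def IsContractiveMultiplier (Θ : 𝔻 → (U →L[ℂ] Y)) : Prop :=
  ∀ f : BergmanSpace n U, ∃ g : BergmanSpace n Y, (∀ z, g z = Θ z (f z)) ∧ ‖g‖ ≤ ‖f‖

variable {n}

/-- The multiplication operator `M_Θ : A_n(U) → A_n(Y)`, `(M_Θ f)(z) = Θ(z) f(z)`. -/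
def mulOperator {Θ : 𝔻 → (U →L[ℂ] Y)} (hΘ : IsContractiveMultiplier n Θ) :
    BergmanSpace n U →L[ℂ] BergmanSpace n Y :=
  LinearMap.mkContinuous
    { toFun := fun f => (hΘ f).choose
      map_add' := fun f g => by
        ext z
        rw [BergmanSpace.add_apply, (hΘ (f + g)).choose_spec.1,
          (hΘ f).choose_spec.1, (hΘ g).choose_spec.1]
        simp
      map_smul' := fun c f => by
        ext z
        rw [BergmanSpace.smul_apply, (hΘ (c • f)).choose_spec.1,
          (hΘ f).choose_spec.1]
        simp }
    1 (fun f => by simpa using (hΘ f).choose_spec.2)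

theorem mulOperator_apply {Θ : 𝔻 → (U →L[ℂ] Y)} (hΘ : IsContractiveMultiplier n Θ)
    (f : BergmanSpace n U) (z : 𝔻) : mulOperator hΘ f z = Θ z (f z) :=
  (hΘ f).choose_spec.1 z

end Multiplier

/-! ### Hypercontractions and strong stability -/

section Operators

variable {X : Type*} [NormedAddCommGroup X] [InnerProductSpace ℂ X] [CompleteSpace X]

/-- `Γ_{k,A}[H] = ∑_{j=0}^k (-1)^j (k choose j) A^{*j} H A^j`. -/
def hereditaryGamma (k : ℕ) (A H : X →L[ℂ] X) : X →L[ℂ] X :=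
  ∑ j ∈ Finset.range (k + 1),
    ((-1 : ℂ) ^ j * (k.choose j : ℂ)) • ((A.adjoint ^ j) * H * A ^ j)

/-- `A` is an `n`-hypercontraction: `Γ_{k,A}[I] ≥ 0` for all `0 ≤ k ≤ n`. -/
def IsHypercontraction (n : ℕ) (A : X →L[ℂ] X) : Prop :=
  ∀ k ≤ n, (hereditaryGamma k A 1).IsPositive

/-- `A` is strongly stable: `‖A^k x‖ → 0` for every `x`. -/
def IsStronglyStable (A : X →L[ℂ] X) : Prop :=
  ∀ x, Filter.Tendsto (fun k : ℕ => ‖(A ^ k) x‖) Filter.atTop (𝓝 0)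

end Operators

/-! ### Hilbert spaces of functions on the disk

A Hilbert space `M` whose elements are `Y`-valued functions on the disk, with the pointwise
vector space operations, is given as a Hilbert space `M` with an injective linear map
`ev : M → (𝔻 → Y)` sending an element to the function that it is. -/

section FunctionSpaces

variable {M Y : Type*} [NormedAddCommGroup M] [InnerProductSpace ℂ M]
  [NormedAddCommGroup Y] [InnerProductSpace ℂ Y] (n : ℕ) (ev : M →ₗ[ℂ] (𝔻 → Y))

/-- `M` is contractively included in `A_n(Y)`: every `m ∈ M` belongs to `A_n(Y)`, and its norm
there is at most its norm in `M`. -/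
def IsContractivelyIncluded : Prop :=
  ∀ m : M, ∃ f : BergmanSpace n Y, (∀ z, f z = ev m z) ∧ ‖f‖ ≤ ‖m‖

variable {n ev}

/-- The inclusion operator `M → A_n(Y)`. -/
def bergmanInclusion (h : IsContractivelyIncluded n ev) : M →L[ℂ] BergmanSpace n Y :=
  LinearMap.mkContinuous
    { toFun := fun m => (h m).choose
      map_add' := fun f g => by
        ext z
        rw [BergmanSpace.add_apply, (h (f + g)).choose_spec.1,
          (h f).choose_spec.1, (h g).choose_spec.1]
        simp
      map_smul' := fun c f => by
        ext z
        rw [BergmanSpace.smul_apply, (h (c • f)).choose_spec.1,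
          (h f).choose_spec.1]
        simp }
    1 (fun m => by simpa using (h m).choose_spec.2)

theorem bergmanInclusion_apply (h : IsContractivelyIncluded n ev) (m : M) (z : 𝔻) :
    bergmanInclusion h m z = ev m z :=
  (h m).choose_spec.1 z

theorem bergmanInclusion_injective (hev : Function.Injective ev)
    (h : IsContractivelyIncluded n ev) : Function.Injective (bergmanInclusion h) :=
  fun m m' hm => hev (funext fun z => by
    rw [← bergmanInclusion_apply h m, hm, bergmanInclusion_apply])

/-- `S_n M ⊆ M`. -/
def IsShiftInvariant (h : IsContractivelyIncluded n ev) : Prop :=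
  ∀ m : M, ∃ m' : M, bergmanInclusion h m' = bergmanShift n Y (bergmanInclusion h m)

/-- The restriction `S_n|_M` as an operator on the Hilbert space `M`; it is bounded by the closed
graph theorem. -/
def shiftRestriction [CompleteSpace M] (hev : Function.Injective ev)
    (h : IsContractivelyIncluded n ev) (hS : IsShiftInvariant h) : M →L[ℂ] M :=
  ContinuousLinearMap.ofSeqClosedGraph
    (g :=
      { toFun := fun m => (hS m).choose
        map_add' := fun m m' => bergmanInclusion_injective hev h (by
          rw [(hS (m + m')).choose_spec, map_add, map_add, map_add, (hS m).choose_spec,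
            (hS m').choose_spec])
        map_smul' := fun c m => bergmanInclusion_injective hev h (by
          rw [(hS (c • m)).choose_spec, map_smul, map_smul, map_smul, (hS m).choose_spec]
          rfl) })
    (fun u x y hu hy => bergmanInclusion_injective hev h (by
      have h1 := ((bergmanInclusion h).continuous.tendsto y).comp hy
      have h2 := ((bergmanShift n Y ∘L bergmanInclusion h).continuous.tendsto x).comp hu
      have h3 : ⇑(bergmanInclusion h) ∘ (fun m => (hS m).choose) ∘ u =
          ⇑(bergmanShift n Y ∘L bergmanInclusion h) ∘ u :=
        funext fun i => (hS (u i)).choose_spec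
      exact (tendsto_nhds_unique (h3 ▸ h1) h2).trans (hS x).choose_spec.symm))

theorem inclusion_shiftRestriction [CompleteSpace M] (hev : Function.Injective ev)
    (h : IsContractivelyIncluded n ev) (hS : IsShiftInvariant h) (m : M) :
    bergmanInclusion h (shiftRestriction hev h hS m) =
      bergmanShift n Y (bergmanInclusion h m) :=
  (hS m).choose_spec

/-- `M = Θ · A_n(U)` with the lifted norm `‖Θ f‖_M = ‖Q f‖`, where `Q` is the orthogonal
projection of `A_n(U)` onto `(Ker M_Θ)^⊥`. -/
structure IsLiftedRange {U : Type*} [NormedAddCommGroup U] [InnerProductSpace ℂ U]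
    [CompleteSpace U] (ev : M →ₗ[ℂ] (𝔻 → Y)) {Θ : 𝔻 → (U →L[ℂ] Y)}
    (hΘ : IsContractiveMultiplier n Θ) : Prop where
  range_eq : Set.range ev =
    Set.range (fun (f : BergmanSpace n U) (z : 𝔻) => Θ z (f z))
  norm_eq : ∀ (m : M) (f : BergmanSpace n U), (∀ z, ev m z = Θ z (f z)) →
    ‖m‖ = ‖((mulOperator hΘ).ker)ᗮ.starProjection f‖

end FunctionSpaces

end

/-! The adjoint `S_n^*` on `A_n(E)` is the universal model: strongly stable `n`-hypercontractions
are, up to unitary equivalence, its restrictions to closed invariant subspaces. Both directions of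
the theorem pass through an isometric intertwiner with this model.

Conditions to multiplier: factor `Γ_{n,A}[I] = D*D` and set `(O x)(z) = ∑ μ_{n,j}⁻¹ (D A^j x) z^j`.
This `O : M → A_n(M)` is isometric and `O A = S_n^* O` (`exists_observability`). Taking adjoints,
the inclusion of `M` followed after `O^*` intertwines the Bergman shifts, hence is multiplication by
some `Θ` (`apply_eq_symbol`). As `O^*` is a coisometry, it is onto `M`, and `‖O^* f‖` is the norm of
the projection of `f` onto `(Ker O^*)^⊥ = (Ker M_Θ)^⊥`: this is the lifted norm.

Multiplier to conditions: `T : f ↦ Θ f` is a coisometry onto `M` with `T S_n = S_n|_M T`, so `T^*`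
embeds `A` isometrically into `S_n^*`, and both properties of the model descend to `A`.

The analytic core concerns the sequence `a k = ‖A^k x‖²`. Its `m`-th backward difference at `k` is
the quadratic form of `Γ_{m,A}[I]` at `A^k x`, so hypercontractivity says that the differences up to
order `n` are nonnegative. Together with `a k → 0`, repeated summation by parts recovers `a 0` from
the `n`-th differences (`hasSum_multichoose_mul_backDiff`), which is the isometry of `O`. For the
model, the differences are computed explicitly by Pascal's rule (`hasSum_backDiff_shift_adjoint`).
-/

noncomputable section

/-! ### Backward differences and summation by parts -/

/-- The backward difference `a k - a (k + 1)` of a real sequence. -/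
def backDiff (a : ℕ → ℝ) (k : ℕ) : ℝ := a k - a (k + 1)

theorem backDiff_iterate_succ (a : ℕ → ℝ) (m k : ℕ) :
    backDiff^[m + 1] a k = backDiff^[m] a k - backDiff^[m] a (k + 1) := by
  rw [Function.iterate_succ_apply']; rfl

theorem backDiff_iterate_eq_sum (m : ℕ) : ∀ (a : ℕ → ℝ) (k : ℕ), backDiff^[m] a k =
    ∑ j ∈ Finset.range (m + 1), ((-1 : ℝ) ^ j * (m.choose j : ℝ)) * a (k + j) := by
  have key : ∀ (a : ℕ → ℝ) (k : ℕ), backDiff^[m] a k = (-1) ^ m * (fwdDiff 1)^[m] a k := by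
    induction m with
    | zero => simp
    | succ m ih =>
      intro a k
      rw [backDiff_iterate_succ, ih, ih, Function.iterate_succ_apply', fwdDiff]
      ring
  intro a k
  rw [key, fwdDiff_iter_eq_sum_shift, Finset.mul_sum]
  refine Finset.sum_congr rfl fun j hj => ?_
  have hj' : j ≤ m := by simpa [Nat.lt_succ_iff] using hj
  have e : (-1 : ℝ) ^ m * (-1) ^ (m - j) = (-1) ^ j := by
    obtain ⟨i, rfl⟩ := Nat.exists_eq_add_of_le hj'
    rw [Nat.add_sub_cancel_left, pow_add, mul_assoc, ← mul_pow]
    simp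
  rw [← e]
  simp [zsmul_eq_mul, mul_assoc]

theorem tendsto_backDiff_iterate {a : ℕ → ℝ} (ha : Filter.Tendsto a Filter.atTop (𝓝 0)) (m : ℕ) :
    Filter.Tendsto (backDiff^[m] a) Filter.atTop (𝓝 0) := by
  induction m with
  | zero => exact ha
  | succ m ih =>
    have := ih.sub ((Filter.tendsto_add_atTop_iff_nat 1).2 ih)
    rw [sub_zero] at this
    exact this.congr fun k => (backDiff_iterate_succ a m k).symm

/-- The partial sums telescope and the far endpoint tends to zero; nonnegative terms turn
convergence of partial sums into `HasSum`. -/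
theorem hasSum_backDiff {b : ℕ → ℝ} (hb : Filter.Tendsto b Filter.atTop (𝓝 0))
    (h : ∀ k, 0 ≤ backDiff b k) (j : ℕ) : HasSum (fun i => backDiff b (j + i)) (b j) := by
  rw [hasSum_iff_tendsto_nat_of_nonneg fun i => h _]
  have h1 : ∀ N, ∑ i ∈ Finset.range N, backDiff b (j + i) = b j - b (j + N) := fun N =>
    Finset.sum_range_sub' (fun i => b (j + i)) N
  simp only [h1]
  have h2 : Filter.Tendsto (fun N => b (j + N)) Filter.atTop (𝓝 0) := by
    simpa [add_comm] using (Filter.tendsto_add_atTop_iff_nat j).2 hb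
  simpa using h2.const_sub (b j)

theorem sum_range_multichoose (m N : ℕ) :
    ∑ j ∈ Finset.range (N + 1), m.multichoose j = (m + 1).multichoose N := by
  induction N with
  | zero => simp
  | succ N ih => rw [Finset.sum_range_succ, ih, Nat.multichoose_succ_succ, add_comm]

/-- Summation by parts, as Tonelli on the pairs `(j, i)` regrouped along the antidiagonals `j + i =
N`. In the application `d` is the backward difference of `b`. -/
theorem hasSum_mul_add {b c d : ℕ → ℝ} {s : ℝ} (hc : ∀ j, 0 ≤ c j) (hd : ∀ j, 0 ≤ d j)
    (hb : ∀ j, HasSum (fun i => d (j + i)) (b j)) (hs : HasSum (fun j => c j * b j) s) :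
    HasSum (fun N => (∑ j ∈ Finset.range (N + 1), c j) * d N) s := by
  let F : ℕ × ℕ → ℝ := fun p => c p.1 * d (p.1 + p.2)
  have h1 : ∀ j, HasSum (fun i => F (j, i)) (c j * b j) := fun j => (hb j).mul_left (c j)
  have hF : Summable F := by
    refine (summable_prod_of_nonneg fun p => mul_nonneg (hc _) (hd _)).2
      ⟨fun j => (h1 j).summable, ?_⟩
    exact hs.summable.congr fun j => (h1 j).tsum_eq.symm
  have hFs : HasSum F s := by
    have := hF.hasSum.prod_fiberwise h1
    rw [hs.unique this]
    exact hF.hasSum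
  have h2 := (Finset.HasAntidiagonal.sigmaAntidiagonalEquivProd (A := ℕ)).hasSum_iff.2 hFs
  refine (h2.sigma fun N => hasSum_fintype _).congr_fun fun N => ?_
  rw [← Finset.Nat.sum_antidiagonal_eq_sum_range_succ (fun j _ => c j), Finset.sum_mul,
    ← Finset.sum_coe_sort]
  refine Finset.sum_congr rfl fun p _ => ?_
  have hp := Finset.HasAntidiagonal.mem_antidiagonal.1 p.2
  simp [F, hp]

/-- Induction on `m`. For `m = 0` only the term `j = 0` survives. Each summation by parts raises the
order of the difference and replaces the coefficients by their partial sums, which are again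
multichoose numbers. -/
theorem hasSum_multichoose_mul_backDiff {n : ℕ} {a : ℕ → ℝ}
    (ha : Filter.Tendsto a Filter.atTop (𝓝 0))
    (h : ∀ m ≤ n, ∀ k, 0 ≤ backDiff^[m] a k) :
    ∀ m ≤ n, HasSum (fun j => (m.multichoose j : ℝ) * backDiff^[m] a j) (a 0) := by
  intro m
  induction m with
  | zero =>
    intro _
    convert hasSum_single (f := fun j => (Nat.multichoose 0 j : ℝ) * backDiff^[0] a j) 0 ?_ using 1
    · simp
    · rintro (_ | j) hj
      · simp at hj
      · simp
  | succ m ih =>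
    intro hm
    have := hasSum_mul_add (fun j => Nat.cast_nonneg (m.multichoose j)) (h (m + 1) hm)
      (fun j => ?_) (ih (by omega))
    · simpa only [← Nat.cast_sum, sum_range_multichoose] using this
    · rw [Function.iterate_succ_apply']
      refine hasSum_backDiff (tendsto_backDiff_iterate ha m) (fun k => ?_) j
      rw [← Function.iterate_succ_apply' backDiff]
      exact h (m + 1) hm k

/-! ### Hypercontractions in terms of the sequences `‖A^k x‖²` -/

section Operators

variable {X : Type*} [NormedAddCommGroup X] [InnerProductSpace ℂ X] [CompleteSpace X]

theorem inner_hereditaryGamma (m : ℕ) (A : X →L[ℂ] X) (x : X) :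
    inner ℂ (hereditaryGamma m A 1 x) x =
      ((backDiff^[m] (fun k => ‖(A ^ k) x‖ ^ 2) 0 : ℝ) : ℂ) := by
  have h : ∀ j, inner ℂ (((A.adjoint ^ j) * 1 * A ^ j) x) x = ((‖(A ^ j) x‖ ^ 2 : ℝ) : ℂ) := by
    intro j
    rw [mul_one, ← ContinuousLinearMap.star_eq_adjoint, ← star_pow,
      ContinuousLinearMap.star_eq_adjoint]
    simp [ContinuousLinearMap.adjoint_inner_left, inner_self_eq_norm_sq_to_K]
  rw [backDiff_iterate_eq_sum, hereditaryGamma, sum_apply, sum_inner, Complex.ofReal_sum]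
  refine Finset.sum_congr rfl fun j _ => ?_
  rw [smul_apply, inner_smul_left, h]
  simp

/-- Over `ℂ` the quadratic form alone decides positivity, so hypercontractivity depends only on the
numbers `‖A^k x‖`. -/
theorem isPositive_hereditaryGamma_iff (m : ℕ) (A : X →L[ℂ] X) :
    (hereditaryGamma m A 1).IsPositive ↔
      ∀ x, 0 ≤ backDiff^[m] (fun k => ‖(A ^ k) x‖ ^ 2) 0 := by
  rw [ContinuousLinearMap.isPositive_iff_complex]
  refine forall_congr' fun x => ?_
  rw [inner_hereditaryGamma]
  simp

theorem backDiff_iterate_shift (m k : ℕ) : ∀ (a : ℕ → ℝ) (l : ℕ),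
    backDiff^[m] (fun i => a (i + k)) l = backDiff^[m] a (l + k) := by
  induction m with
  | zero => intro a l; rfl
  | succ m ih => intro a l; rw [backDiff_iterate_succ, backDiff_iterate_succ, ih, ih,
      add_right_comm]

omit [CompleteSpace X] in
-- Lets positivity of `Γ_m` at the vector `A^k x` give nonnegativity of the differences at index
-- `k`.
theorem backDiff_norm_pow (A : X →L[ℂ] X) (m k : ℕ) (x : X) :
    backDiff^[m] (fun i => ‖(A ^ i) ((A ^ k) x)‖ ^ 2) 0 =
      backDiff^[m] (fun i => ‖(A ^ i) x‖ ^ 2) k := by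
  have := backDiff_iterate_shift m k (fun i => ‖(A ^ i) x‖ ^ 2) 0
  simpa [pow_add] using this

/-- A strongly stable hypercontraction satisfies
`∑_j (j+n-1 choose j) ‖D A^j x‖² = ‖x‖²`, where `D*D = Γ_{n,A}[I]`. -/
theorem IsHypercontraction.exists_hasSum {n : ℕ} {A : X →L[ℂ] X} (hA : IsHypercontraction n A)
    (hs : IsStronglyStable A) : ∃ D : X →L[ℂ] X, ∀ x,
      HasSum (fun j => (n.multichoose j : ℝ) * ‖D ((A ^ j) x)‖ ^ 2) (‖x‖ ^ 2) := by
  obtain ⟨D, hD⟩ := CStarAlgebra.nonneg_iff_eq_star_mul_self.1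
    ((ContinuousLinearMap.nonneg_iff_isPositive _).2 (hA n le_rfl))
  have hD' : ∀ x, ‖D x‖ ^ 2 = backDiff^[n] (fun k => ‖(A ^ k) x‖ ^ 2) 0 := by
    intro x
    have := inner_hereditaryGamma n A x
    rw [hD, ContinuousLinearMap.star_eq_adjoint, mul_apply_eq_comp,
      ContinuousLinearMap.adjoint_inner_left, inner_self_eq_norm_sq_to_K] at this
    rw [← Complex.ofReal_inj, ← this, Complex.ofReal_pow]
    rfl
  refine ⟨D, fun x => ?_⟩
  have := hasSum_multichoose_mul_backDiff (n := n) (a := fun k => ‖(A ^ k) x‖ ^ 2)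
    (by simpa using (hs x).pow 2) (fun m hm k => ?_) n le_rfl
  · simpa only [hD', backDiff_norm_pow, pow_zero, one_apply_eq_self] using this
  · rw [← backDiff_norm_pow]
    exact (isPositive_hereditaryGamma_iff m A).1 (hA m hm) _

variable {Z : Type*} [NormedAddCommGroup Z] [InnerProductSpace ℂ Z] [CompleteSpace Z]

omit [CompleteSpace X] [CompleteSpace Z] in
theorem pow_intertwine {A : X →L[ℂ] X} {B : Z →L[ℂ] Z} {V : X →L[ℂ] Z}
    (h : V ∘L A = B ∘L V) (k : ℕ) (x : X) : V ((A ^ k) x) = (B ^ k) (V x) := by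
  induction k with
  | zero => simp
  | succ k ih =>
    rw [pow_succ', pow_succ', mul_apply_eq_comp, mul_apply_eq_comp, ← ih]
    exact congrArg (fun T : X →L[ℂ] Z => T ((A ^ k) x)) h

/-- An isometric intertwiner preserves all the norms `‖A^k x‖`, hence all the differences. -/
theorem IsHypercontraction.of_intertwine {n : ℕ} {A : X →L[ℂ] X} {B : Z →L[ℂ] Z} {V : X →L[ℂ] Z}
    (hV : ∀ x, ‖V x‖ = ‖x‖) (h : V ∘L A = B ∘L V) (hB : IsHypercontraction n B) :
    IsHypercontraction n A := by
  intro m hm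
  refine (isPositive_hereditaryGamma_iff m A).2 fun x => ?_
  have := (isPositive_hereditaryGamma_iff m B).1 (hB m hm) (V x)
  simpa only [← pow_intertwine h, hV] using this

omit [CompleteSpace X] [CompleteSpace Z] in
theorem IsStronglyStable.of_intertwine {A : X →L[ℂ] X} {B : Z →L[ℂ] Z} {V : X →L[ℂ] Z}
    (hV : ∀ x, ‖V x‖ = ‖x‖) (h : V ∘L A = B ∘L V) (hB : IsStronglyStable B) :
    IsStronglyStable A := fun x => by
  simpa only [← pow_intertwine h, hV] using hB (V x)

end Operators

/-! ### Coefficients, evaluations and monomials in the Bergman space -/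

theorem inv_bergmanWeight_eq {n : ℕ} (hn : 1 ≤ n) (j : ℕ) :
    (bergmanWeight n j)⁻¹ = (n.multichoose j : ℝ) := by
  rw [bergmanWeight_eq hn, one_div, inv_inv, Nat.multichoose_eq, add_comm]

namespace BergmanSpace

variable {n : ℕ} {Y : Type*} [NormedAddCommGroup Y] [InnerProductSpace ℂ Y]

theorem hasSum_inner (f g : BergmanSpace n Y) :
    HasSum (fun j => (bergmanWeight n j : ℂ) * inner ℂ (coeff f j) (coeff g j)) (inner ℂ f g) := by
  rw [inner_eq_toSeq]
  refine (lp.hasSum_inner (toSeq f) (toSeq g)).congr_fun fun j => ?_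
  rw [toSeq_apply, toSeq_apply, inner_smul_left, inner_smul_right, ← mul_assoc,
    Complex.conj_ofReal, ← Complex.ofReal_mul, Real.mul_self_sqrt (bergmanWeight_pos n j).le]

theorem hasSum_norm_sq (f : BergmanSpace n Y) :
    HasSum (fun j => bergmanWeight n j * ‖coeff f j‖ ^ 2) (‖f‖ ^ 2) :=
  norm_sq_eq f ▸ (summable_coeff f).hasSum

theorem coeff_injective : Function.Injective (coeff : BergmanSpace n Y → ℕ → Y) := by
  intro f g h
  ext z
  exact (hasSum_coeff f z).unique (h ▸ hasSum_coeff g z)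

variable (n Y) in
/-- The `j`-th Taylor coefficient as a bounded operator. -/
def coeffCLM (j : ℕ) : BergmanSpace n Y →L[ℂ] Y :=
  LinearMap.mkContinuous
    { toFun := fun f => coeff f j
      map_add' := fun f g => congrFun (coeff_add f g) j
      map_smul' := fun c f => congrFun (coeff_smul c f) j }
    (√(bergmanWeight n j))⁻¹ fun f => by
      have h := lp.norm_apply_le_norm two_ne_zero (toSeq f) j
      rw [toSeq_apply, norm_smul, norm_toSeq, Complex.norm_real, Real.norm_eq_abs,
        abs_of_nonneg (Real.sqrt_nonneg _)] at h
      rw [inv_mul_eq_div, le_div_iff₀ (Real.sqrt_pos.2 (bergmanWeight_pos n j)), mul_comm]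
      exact h

variable [CompleteSpace Y]

variable (n Y) in
/-- Point evaluation as a bounded operator. -/
def evalCLM (z : 𝔻) : BergmanSpace n Y →L[ℂ] Y :=
  -- Boundedness is Banach–Steinhaus: evaluation is the pointwise limit of the bounded Taylor
  -- partial sums.
  continuousLinearMapOfTendsto (l := Filter.atTop)
    (fun N : ℕ => ∑ j ∈ Finset.range N, (z : ℂ) ^ j • coeffCLM n Y j)
    (f := fun f => f z) (by
      rw [tendsto_pi_nhds]
      intro f
      simpa [coeffCLM] using (hasSum_coeff f z).tendsto_sum_nat)

@[simp] theorem evalCLM_apply (z : 𝔻) (f : BergmanSpace n Y) : evalCLM n Y z f = f z := rfl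

/-- The function in `A_n(Y)` with given Taylor coefficients. -/
def ofCoeff (a : ℕ → Y) (ha : Summable (fun j => bergmanWeight n j * ‖a j‖ ^ 2)) :
    BergmanSpace n Y := (exists_of_summable ha).choose

@[simp] theorem coeff_ofCoeff (a : ℕ → Y)
    (ha : Summable (fun j => bergmanWeight n j * ‖a j‖ ^ 2)) : coeff (ofCoeff a ha) = a :=
  (exists_of_summable ha).choose_spec

variable (n) in
/-- The monomial `u z^j`. -/
def monomial (j : ℕ) (u : Y) : BergmanSpace n Y :=
  ofCoeff (Pi.single j u) (summable_of_ne_finset_zero (s := {j}) fun i hi => by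
    rw [Finset.mem_singleton] at hi
    simp [Pi.single_eq_of_ne hi])

@[simp] theorem coeff_monomial (j : ℕ) (u : Y) : coeff (monomial n j u) = Pi.single j u :=
  coeff_ofCoeff _ _

theorem monomial_apply (j : ℕ) (u : Y) (z : 𝔻) : monomial n j u z = (z : ℂ) ^ j • u := by
  refine (hasSum_coeff (monomial n j u) z).unique ?_
  rw [coeff_monomial]
  convert hasSum_single (f := fun i => (z : ℂ) ^ i • (Pi.single j u : ℕ → Y) i) j ?_ using 1
  · simp
  · intro i hi
    simp [Pi.single_eq_of_ne hi]

theorem shift_monomial (j : ℕ) (u : Y) :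
    bergmanShift n Y (monomial n j u) = monomial n (j + 1) u := by
  ext z
  rw [bergmanShift_apply, monomial_apply, monomial_apply, smul_smul, pow_succ']

theorem inner_monomial (f : BergmanSpace n Y) (j : ℕ) (u : Y) :
    inner ℂ f (monomial n j u) = (bergmanWeight n j : ℂ) * inner ℂ (coeff f j) u := by
  refine (hasSum_inner f (monomial n j u)).unique ?_
  rw [coeff_monomial]
  convert hasSum_single (f := fun i => (bergmanWeight n i : ℂ) *
    inner ℂ (coeff f i) ((Pi.single j u : ℕ → Y) i)) j ?_ using 1
  · simp
  · intro i hi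
    simp [Pi.single_eq_of_ne hi]

/-- Convergence here is in the Bergman norm, transported from `ℓ²`, so that bounded operators may be
applied term by term. -/
theorem hasSum_monomial (f : BergmanSpace n Y) :
    HasSum (fun j => monomial n j (coeff f j)) f := by
  have h := (lp.hasSum_single (E := fun _ : ℕ => Y) (p := 2) (by norm_num) (equivSeq f)).map
    (equivSeq (n := n) (Y := Y)).symm (equivSeq (n := n) (Y := Y)).symm.continuous
  rw [LinearIsometryEquiv.symm_apply_apply] at h
  refine h.congr_fun fun j => ?_
  rw [Function.comp_apply, LinearIsometryEquiv.eq_symm_apply]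
  ext i
  change toSeq (monomial n j (coeff f j)) i =
    lp.single (E := fun _ : ℕ => Y) 2 j (toSeq f j) i
  rw [toSeq_apply, coeff_monomial, toSeq_apply, lp.single_apply]
  rcases eq_or_ne i j with rfl | hij
  · simp
  · simp [Pi.single_eq_of_ne hij]

theorem norm_monomial_zero (hn : 1 ≤ n) (u : Y) : ‖monomial n 0 u‖ = ‖u‖ := by
  rw [← sq_eq_sq₀ (norm_nonneg _) (norm_nonneg _)]
  refine (hasSum_norm_sq _).unique ?_
  rw [coeff_monomial]
  convert hasSum_single (f := fun i => bergmanWeight n i *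
    ‖(Pi.single 0 u : ℕ → Y) i‖ ^ 2) 0 ?_ using 1
  · rw [← inv_inv (bergmanWeight n 0), inv_bergmanWeight_eq hn]
    simp
  · intro i hi
    simp [Pi.single_eq_of_ne hi]

/-! ### The adjoint Bergman shift is a strongly stable hypercontraction -/

/-- Test against `u z^j`, which the shift sends to `u z^(j+1)`; the factor is the ratio of the
weights of these two monomials. -/
theorem coeff_shift_adjoint (f : BergmanSpace n Y) (j : ℕ) :
    coeff ((bergmanShift n Y).adjoint f) j =
      ((bergmanWeight n (j + 1) / bergmanWeight n j : ℝ) : ℂ) • coeff f (j + 1) := by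
  refine ext_inner_right ℂ fun u => ?_
  have h := inner_monomial ((bergmanShift n Y).adjoint f) j u
  rw [ContinuousLinearMap.adjoint_inner_left, shift_monomial, inner_monomial] at h
  have hw : (bergmanWeight n j : ℂ) ≠ 0 := by exact_mod_cast (bergmanWeight_pos n j).ne'
  rw [inner_smul_left, Complex.conj_ofReal]
  push_cast
  rw [div_mul_eq_mul_div, h]
  field_simp

theorem coeff_shift_adjoint_pow (f : BergmanSpace n Y) (k : ℕ) : ∀ j : ℕ,
    coeff (((bergmanShift n Y).adjoint ^ k) f) j =
      ((bergmanWeight n (j + k) / bergmanWeight n j : ℝ) : ℂ) • coeff f (j + k) := by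
  induction k with
  | zero => intro j; simp [(bergmanWeight_pos n j).ne']
  | succ k ih =>
    intro j
    rw [pow_succ', mul_apply_eq_comp, coeff_shift_adjoint, ih, smul_smul,
      ← Complex.ofReal_mul, add_right_comm, add_assoc j k 1]
    congr 2
    have := (bergmanWeight_pos n (j + 1)).ne'
    have := (bergmanWeight_pos n j).ne'
    field_simp

/-- The number `(i - k + r - 1 choose r - 1)`, zero for `i < k`. -/
def shiftedMultichoose (r i k : ℕ) : ℝ := if k ≤ i then (r.multichoose (i - k) : ℝ) else 0

theorem shiftedMultichoose_nonneg (r i k : ℕ) : 0 ≤ shiftedMultichoose r i k := by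
  unfold shiftedMultichoose; split_ifs <;> positivity

/-- Pascal's rule: a backward difference in `k` lowers `r` by one. The truncation at `i < k` is
consistent with it because both sides equal `1` at `i = k`. -/
theorem shiftedMultichoose_sub (r i k : ℕ) :
    shiftedMultichoose (r + 1) i k - shiftedMultichoose (r + 1) i (k + 1) =
      shiftedMultichoose r i k := by
  unfold shiftedMultichoose
  rcases lt_trichotomy i k with h | rfl | h
  · rw [if_neg (by omega), if_neg (by omega), if_neg (by omega), sub_zero]
  · simp
  · obtain ⟨d, rfl⟩ := Nat.exists_eq_add_of_lt h
    rw [if_pos (by omega), if_pos (by omega), if_pos (by omega),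
      show k + d + 1 - k = d + 1 by omega, show k + d + 1 - (k + 1) = d by omega,
      Nat.multichoose_succ_succ]
    push_cast
    ring

/-- Reindexing by `i = j + k`, the weight becomes `μ_i² / μ_{i-k}`, and `1 / μ_{i-k}` is a
multichoose number. All dependence on `k` is thereby isolated in one factor. -/
theorem hasSum_norm_shift_adjoint_pow (hn : 1 ≤ n) (f : BergmanSpace n Y) (k : ℕ) :
    HasSum (fun i => bergmanWeight n i ^ 2 * ‖coeff f i‖ ^ 2 * shiftedMultichoose n i k)
      (‖((bergmanShift n Y).adjoint ^ k) f‖ ^ 2) := by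
  rw [← hasSum_nat_add_iff' k]
  have h0 : ∑ i ∈ Finset.range k,
      bergmanWeight n i ^ 2 * ‖coeff f i‖ ^ 2 * shiftedMultichoose n i k = 0 :=
    Finset.sum_eq_zero fun i hi => by
      rw [shiftedMultichoose, if_neg (by simpa using hi), mul_zero]
  rw [h0, sub_zero]
  refine (hasSum_norm_sq (((bergmanShift n Y).adjoint ^ k) f)).congr_fun fun j => ?_
  rw [coeff_shift_adjoint_pow, shiftedMultichoose, if_pos (by omega), Nat.add_sub_cancel,
    ← inv_bergmanWeight_eq hn, norm_smul, Complex.norm_real, Real.norm_eq_abs, mul_pow, sq_abs]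
  have := (bergmanWeight_pos n j).ne'
  field_simp

/-- This is `μ_i / μ_{i-k} ≤ 1`; it dominates the series for every `k` by the one for `‖f‖²`. -/
theorem shiftedMultichoose_le (hn : 1 ≤ n) (i k : ℕ) :
    bergmanWeight n i * shiftedMultichoose n i k ≤ 1 := by
  rw [← le_inv_mul_iff₀ (bergmanWeight_pos n i), mul_one, inv_bergmanWeight_eq hn]
  unfold shiftedMultichoose
  split_ifs
  · have : n.multichoose (i - k) ≤ n.multichoose i := by
      rw [Nat.multichoose_eq, Nat.multichoose_eq,
        ← Nat.choose_symm_of_eq_add (show n + (i - k) - 1 = (n - 1) + (i - k) by omega),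
        ← Nat.choose_symm_of_eq_add (show n + i - 1 = (n - 1) + i by omega)]
      exact Nat.choose_le_choose _ (by omega)
    exact_mod_cast this
  · positivity

theorem isStronglyStable_shift_adjoint (hn : 1 ≤ n) :
    IsStronglyStable (bergmanShift n Y).adjoint := by
  intro f
  have h : Filter.Tendsto (fun k => ‖((bergmanShift n Y).adjoint ^ k) f‖ ^ 2) Filter.atTop
      (𝓝 0) := by
    simp_rw [← (hasSum_norm_shift_adjoint_pow hn f _).tsum_eq]
    rw [← tsum_zero (α := ℝ) (β := ℕ)]
    refine tendsto_tsum_of_dominated_convergence (summable_coeff f) (fun i => ?_)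
      (Filter.Eventually.of_forall fun k i => ?_)
    -- Each fixed term vanishes once `k > i`.
    · refine tendsto_const_nhds.congr' ?_
      filter_upwards [Filter.eventually_gt_atTop i] with k hk
      rw [shiftedMultichoose, if_neg (by omega), mul_zero]
    · have hw := (bergmanWeight_pos n i).le
      rw [Real.norm_eq_abs, abs_of_nonneg (mul_nonneg (by positivity)
        (shiftedMultichoose_nonneg n i k))]
      have := mul_le_mul_of_nonneg_left (shiftedMultichoose_le hn i k)
        (show 0 ≤ bergmanWeight n i * ‖coeff f i‖ ^ 2 by positivity)
      linarith
  simpa using h.sqrt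

/-- Differencing termwise `m` times lowers `r` from `n` to `n - m`, so for `m ≤ n` the terms stay
visibly nonnegative. -/
theorem hasSum_backDiff_shift_adjoint (hn : 1 ≤ n) (f : BergmanSpace n Y) (m : ℕ) :
    ∀ r k : ℕ, m + r = n →
      HasSum (fun i => bergmanWeight n i ^ 2 * ‖coeff f i‖ ^ 2 * shiftedMultichoose r i k)
        (backDiff^[m] (fun k => ‖((bergmanShift n Y).adjoint ^ k) f‖ ^ 2) k) := by
  induction m with
  | zero =>
    rintro r k hr
    rw [zero_add] at hr
    subst hr
    exact hasSum_norm_shift_adjoint_pow hn f k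
  | succ m ih =>
    intro r k hr
    rw [backDiff_iterate_succ]
    refine ((ih (r + 1) k (by omega)).sub (ih (r + 1) (k + 1) (by omega))).congr_fun fun i => ?_
    rw [← mul_sub, shiftedMultichoose_sub]

theorem isHypercontraction_shift_adjoint (hn : 1 ≤ n) :
    IsHypercontraction n (bergmanShift n Y).adjoint := by
  intro m hm
  refine (isPositive_hereditaryGamma_iff m _).2 fun f => ?_
  exact (hasSum_backDiff_shift_adjoint hn f m (n - m) 0 (by omega)).nonneg fun i =>
    mul_nonneg (by positivity) (shiftedMultichoose_nonneg _ _ _)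

end BergmanSpace

/-! ### Operators intertwining Bergman shifts are multiplications -/

section Intertwining

variable {n : ℕ} {U Y : Type*} [NormedAddCommGroup U] [InnerProductSpace ℂ U] [CompleteSpace U]
  [NormedAddCommGroup Y] [InnerProductSpace ℂ Y] [CompleteSpace Y]

/-- The operator-valued function with `Θ(z) u = (B u)(z)`, where `u ∈ U` is considered as a
constant function. -/
def symbol (hn : 1 ≤ n) (B : BergmanSpace n U →L[ℂ] BergmanSpace n Y) (z : 𝔻) : U →L[ℂ] Y :=
  BergmanSpace.evalCLM n Y z ∘L B ∘L LinearMap.mkContinuous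
    { toFun := BergmanSpace.monomial n 0
      map_add' := fun u v => by ext z; simp [BergmanSpace.monomial_apply]
      map_smul' := fun c u => by ext z; simp [BergmanSpace.monomial_apply] }
    1 fun u => by
      rw [one_mul]
      exact (BergmanSpace.norm_monomial_zero hn u).le

/-- An operator intertwining the Bergman shifts is the multiplication by its symbol. -/
theorem apply_eq_symbol (hn : 1 ≤ n) {B : BergmanSpace n U →L[ℂ] BergmanSpace n Y}
    (hB : B ∘L bergmanShift n U = bergmanShift n Y ∘L B) (f : BergmanSpace n U) (z : 𝔻) :
    B f z = symbol hn B z (f z) := by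
  have hmono : ∀ (j : ℕ) (u : U), B (BergmanSpace.monomial n j u) z =
      (z : ℂ) ^ j • symbol hn B z u := by
    intro j u
    induction j with
    | zero => rw [pow_zero, one_smul]; rfl
    | succ j ih =>
      rw [← BergmanSpace.shift_monomial, ← ContinuousLinearMap.comp_apply, hB,
        ContinuousLinearMap.comp_apply, bergmanShift_apply, ih, smul_smul, pow_succ']
  -- Two expansions with the same terms: apply `B` and then evaluate at `z`, or evaluate `f` at `z`
  -- and then apply the symbol.
  have h1 := ((BergmanSpace.hasSum_monomial f).mapL B).mapL (BergmanSpace.evalCLM n Y z)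
  have h2 := (BergmanSpace.hasSum_coeff f z).mapL (symbol hn B z)
  simp only [BergmanSpace.evalCLM_apply, hmono] at h1
  simp only [map_smul] at h2
  exact h1.unique h2

theorem isContractiveMultiplier_symbol (hn : 1 ≤ n)
    {B : BergmanSpace n U →L[ℂ] BergmanSpace n Y}
    (hB : B ∘L bergmanShift n U = bergmanShift n Y ∘L B) (hB' : ∀ f, ‖B f‖ ≤ ‖f‖) :
    IsContractiveMultiplier n (symbol hn B) :=
  fun f => ⟨B f, apply_eq_symbol hn hB f, hB' f⟩

end Intertwining

/-! ### The observability operator -/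

/-- A strongly stable `n`-hypercontraction is the restriction of the adjoint Bergman shift to an
invariant subspace: the observability operator is an isometric intertwiner. -/
theorem exists_observability {X : Type*} [NormedAddCommGroup X] [InnerProductSpace ℂ X]
    [CompleteSpace X] {n : ℕ} (hn : 1 ≤ n) {A : X →L[ℂ] X} (hA : IsHypercontraction n A)
    (hs : IsStronglyStable A) : ∃ O : X →L[ℂ] BergmanSpace n X,
      (∀ x, ‖O x‖ = ‖x‖) ∧ O ∘L A = (bergmanShift n X).adjoint ∘L O := by
  obtain ⟨D, hD⟩ := hA.exists_hasSum hs
  -- The factor `μ_j⁻¹` serves both claims: `μ_j · μ_j⁻²` is the coefficient in `hD`, and `(μ_{j+1}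
  -- / μ_j) · μ_{j+1}⁻¹ = μ_j⁻¹` gives the intertwining. Coefficients are taken in all of `X`, with
  -- no restriction to the closed range of `D`.
  let a : X → ℕ → X := fun x j => (((bergmanWeight n j)⁻¹ : ℝ) : ℂ) • D ((A ^ j) x)
  have ha : ∀ x, HasSum (fun j => bergmanWeight n j * ‖a x j‖ ^ 2) (‖x‖ ^ 2) := fun x => by
    refine (hD x).congr_fun fun j => ?_
    have hw := bergmanWeight_pos n j
    rw [← inv_bergmanWeight_eq hn, norm_smul, Complex.norm_real, Real.norm_eq_abs, mul_pow, sq_abs]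
    field_simp
  have hnorm : ∀ x, ‖BergmanSpace.ofCoeff (a x) (ha x).summable‖ = ‖x‖ := fun x => by
    rw [← sq_eq_sq₀ (norm_nonneg _) (norm_nonneg _)]
    refine (BergmanSpace.hasSum_norm_sq _).unique ?_
    rw [BergmanSpace.coeff_ofCoeff]
    exact ha x
  refine ⟨LinearMap.mkContinuous
    { toFun := fun x => BergmanSpace.ofCoeff (a x) (ha x).summable
      map_add' := fun x y => BergmanSpace.coeff_injective (by
        rw [BergmanSpace.coeff_add]
        funext j
        simp only [BergmanSpace.coeff_ofCoeff, Pi.add_apply, a, map_add, smul_add])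
      map_smul' := fun c x => BergmanSpace.coeff_injective (by
        rw [RingHom.id_apply, BergmanSpace.coeff_smul]
        funext j
        simp only [BergmanSpace.coeff_ofCoeff, Pi.smul_apply, a, map_smul]
        rw [smul_comm]) }
    1 fun x => by rw [one_mul]; exact (hnorm x).le, hnorm, ?_⟩
  ext1 x
  refine BergmanSpace.coeff_injective (funext fun j => ?_)
  rw [ContinuousLinearMap.comp_apply, ContinuousLinearMap.comp_apply,
    BergmanSpace.coeff_shift_adjoint]
  change BergmanSpace.coeff (BergmanSpace.ofCoeff (a (A x)) (ha (A x)).summable) j =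
    _ • BergmanSpace.coeff (BergmanSpace.ofCoeff (a x) (ha x).summable) (j + 1)
  rw [BergmanSpace.coeff_ofCoeff, BergmanSpace.coeff_ofCoeff, smul_smul, ← Complex.ofReal_mul,
    pow_succ, mul_apply_eq_comp]
  change (((bergmanWeight n j)⁻¹ : ℝ) : ℂ) • D ((A ^ j) (A x)) = _
  congr 2
  have := (bergmanWeight_pos n (j + 1)).ne'
  field_simp

/-! ### From the three conditions to a multiplier -/

section Isometry

variable {X Z : Type*} [NormedAddCommGroup X] [InnerProductSpace ℂ X] [CompleteSpace X]
  [NormedAddCommGroup Z] [InnerProductSpace ℂ Z] [CompleteSpace Z]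

theorem adjoint_apply_apply_of_isometry {V : X →L[ℂ] Z} (hV : ∀ x, ‖V x‖ = ‖x‖) (x : X) :
    V.adjoint (V x) = x := by
  have := (ContinuousLinearMap.norm_map_iff_adjoint_comp_self V).1 hV
  exact congrArg (fun T : X →L[ℂ] X => T x) this

theorem norm_adjoint_apply_le_of_isometry {V : X →L[ℂ] Z} (hV : ∀ x, ‖V x‖ = ‖x‖) (z : Z) :
    ‖V.adjoint z‖ ≤ ‖z‖ := by
  have h : ‖V.adjoint‖ ≤ 1 := by
    rw [LinearIsometryEquiv.norm_map]
    exact V.opNorm_le_bound zero_le_one fun x => by rw [hV, one_mul]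
  simpa using V.adjoint.le_of_opNorm_le h z

/-- For an isometry `V`, the projection onto `(Ker V^*)^⊥` is `V V^*`, and the outer `V` does not
change norms. -/
theorem norm_starProjection_ker_adjoint_orthogonal {V : X →L[ℂ] Z} (hV : ∀ x, ‖V x‖ = ‖x‖)
    (z : Z) : ‖(V.adjoint.ker)ᗮ.starProjection z‖ = ‖V.adjoint z‖ := by
  rw [← hV (V.adjoint z)]
  congr 1
  refine Submodule.eq_starProjection_of_mem_orthogonal ?_
    (Submodule.le_orthogonal_orthogonal _ ?_)
  · intro k hk
    rw [← ContinuousLinearMap.adjoint_inner_left]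
    exact (congrArg (inner ℂ · _) (LinearMap.mem_ker.1 hk)).trans (inner_zero_left _)
  · rw [LinearMap.mem_ker]
    change V.adjoint (z - V (V.adjoint z)) = 0
    rw [map_sub, adjoint_apply_apply_of_isometry hV, sub_self]

end Isometry

theorem norm_bergmanInclusion_le {M Y : Type*} [NormedAddCommGroup M] [InnerProductSpace ℂ M]
    [NormedAddCommGroup Y] [InnerProductSpace ℂ Y] {n : ℕ} {ev : M →ₗ[ℂ] (𝔻 → Y)}
    (h : IsContractivelyIncluded n ev) (m : M) : ‖bergmanInclusion h m‖ ≤ ‖m‖ :=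
  (h m).choose_spec.2

/-- The coefficient space is `M` itself and `Θ` is the symbol of the inclusion composed with `O^*`.
-/
theorem exists_isLiftedRange {M : Type u} {Y : Type v}
    [NormedAddCommGroup M] [InnerProductSpace ℂ M] [CompleteSpace M]
    [NormedAddCommGroup Y] [InnerProductSpace ℂ Y] [CompleteSpace Y]
    {n : ℕ} (hn : 1 ≤ n) {ev : M →ₗ[ℂ] (𝔻 → Y)} (hev : Function.Injective ev)
    (h₁ : IsContractivelyIncluded n ev) (h₂ : IsShiftInvariant h₁)
    (hs : IsStronglyStable (shiftRestriction hev h₁ h₂).adjoint)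
    (hA : IsHypercontraction n (shiftRestriction hev h₁ h₂).adjoint) :
    ∃ (Θ : 𝔻 → (M →L[ℂ] Y)) (hΘ : IsContractiveMultiplier n Θ), IsLiftedRange ev hΘ := by
  obtain ⟨O, hO, hOA⟩ := exists_observability hn hA hs
  have hR : shiftRestriction hev h₁ h₂ ∘L O.adjoint = O.adjoint ∘L bergmanShift n M := by
    have := congrArg ContinuousLinearMap.adjoint hOA
    simpa only [ContinuousLinearMap.adjoint_comp, ContinuousLinearMap.adjoint_adjoint] using this
  let B : BergmanSpace n M →L[ℂ] BergmanSpace n Y := bergmanInclusion h₁ ∘L O.adjoint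
  have hB : B ∘L bergmanShift n M = bergmanShift n Y ∘L B := by
    ext1 f
    change bergmanInclusion h₁ ((O.adjoint ∘L bergmanShift n M) f) =
      bergmanShift n Y (bergmanInclusion h₁ (O.adjoint f))
    rw [← hR, ContinuousLinearMap.comp_apply, inclusion_shiftRestriction]
  have hev_symbol : ∀ (f : BergmanSpace n M) (z : 𝔻),
      ev (O.adjoint f) z = symbol hn B z (f z) := fun f z => by
    rw [← apply_eq_symbol hn hB, ← bergmanInclusion_apply h₁]
    rfl
  have hΘ : IsContractiveMultiplier n (symbol hn B) :=
    isContractiveMultiplier_symbol hn hB fun f =>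
      (norm_bergmanInclusion_le h₁ _).trans (norm_adjoint_apply_le_of_isometry hO f)
  -- The inclusion is injective, so composing with it leaves the kernel unchanged; the lifted norm
  -- can then be computed from `O^*` alone.
  have hker : (mulOperator hΘ).ker = O.adjoint.ker := by
    ext f
    rw [LinearMap.mem_ker, LinearMap.mem_ker]
    have : mulOperator hΘ f = B f := by
      ext z
      rw [mulOperator_apply, apply_eq_symbol hn hB]
    change mulOperator hΘ f = 0 ↔ O.adjoint f = 0
    rw [this]
    exact map_eq_zero_iff _ (bergmanInclusion_injective hev h₁)
  refine ⟨symbol hn B, hΘ, ?_, fun m f hmf => ?_⟩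
  · ext g
    constructor
    · rintro ⟨m, rfl⟩
      -- `O m` is a preimage of `m`, since `O^* O = 1`.
      exact ⟨O m, funext fun z => by
        change symbol hn B z (O m z) = _
        rw [← hev_symbol, adjoint_apply_apply_of_isometry hO]⟩
    · rintro ⟨f, rfl⟩
      exact ⟨O.adjoint f, funext fun z => hev_symbol f z⟩
  · have hm : m = O.adjoint f := hev (funext fun z => by rw [hmf, hev_symbol])
    simp only [hker]
    rw [norm_starProjection_ker_adjoint_orthogonal hO, hm]

/-! ### From a multiplier to the three conditions -/

namespace IsLiftedRange

variable {M Y U : Type*} [NormedAddCommGroup M] [InnerProductSpace ℂ M]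
  [NormedAddCommGroup Y] [InnerProductSpace ℂ Y]
  [NormedAddCommGroup U] [InnerProductSpace ℂ U] [CompleteSpace U] {n : ℕ}
  {ev : M →ₗ[ℂ] (𝔻 → Y)} {Θ : 𝔻 → (U →L[ℂ] Y)} {hΘ : IsContractiveMultiplier n Θ}

theorem exists_lift (hL : IsLiftedRange ev hΘ) (f : BergmanSpace n U) :
    ∃ m : M, ∀ z, ev m z = Θ z (f z) := by
  obtain ⟨m, hm⟩ : (fun z => Θ z (f z)) ∈ Set.range ev := hL.range_eq ▸ ⟨f, rfl⟩
  exact ⟨m, congrFun hm⟩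

/-- Replace any representative `f` by its projection `Q f`: the difference lies in `Ker M_Θ`, so the
product is unchanged, and `‖Q f‖` is the lifted norm. -/
theorem exists_norm_eq (hL : IsLiftedRange ev hΘ) (m : M) :
    ∃ f : BergmanSpace n U, (∀ z, ev m z = Θ z (f z)) ∧ ‖f‖ = ‖m‖ := by
  obtain ⟨f, hf⟩ : ev m ∈ Set.range (fun (f : BergmanSpace n U) (z : 𝔻) => Θ z (f z)) :=
    hL.range_eq ▸ ⟨m, rfl⟩
  refine ⟨(mulOperator hΘ).kerᗮ.starProjection f, fun z => ?_,
    (hL.norm_eq m f fun z => (congrFun hf z).symm).symm⟩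
  -- A priori `f - Q f` lies in the double orthogonal complement, which is the kernel because the
  -- kernel is closed.
  have hmem : f - (mulOperator hΘ).kerᗮ.starProjection f ∈ (mulOperator hΘ).ker := by
    have : IsClosed ((mulOperator hΘ).ker : Set (BergmanSpace n U)) :=
      (mulOperator hΘ).isClosed_ker
    have h := (mulOperator hΘ).kerᗮ.sub_starProjection_mem_orthogonal f
    rwa [Submodule.orthogonal_orthogonal_eq_closure, this.submodule_topologicalClosure_eq] at h
  have h0 : mulOperator hΘ f = mulOperator hΘ ((mulOperator hΘ).kerᗮ.starProjection f) := by
    rw [← sub_eq_zero, ← map_sub]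
    exact hmem
  rw [← mulOperator_apply hΘ, ← h0, mulOperator_apply]
  exact (congrFun hf z).symm

theorem isContractivelyIncluded (hL : IsLiftedRange ev hΘ) : IsContractivelyIncluded n ev := by
  intro m
  obtain ⟨f, hf, hfm⟩ := hL.exists_norm_eq m
  obtain ⟨g, hg, hgf⟩ := hΘ f
  exact ⟨g, fun z => by rw [hg, hf], hgf.trans_eq hfm⟩

theorem isShiftInvariant (hL : IsLiftedRange ev hΘ) (h₁ : IsContractivelyIncluded n ev) :
    IsShiftInvariant h₁ := by
  intro m
  obtain ⟨f, hf, -⟩ := hL.exists_norm_eq m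
  obtain ⟨m', hm'⟩ := hL.exists_lift (bergmanShift n U f)
  refine ⟨m', ?_⟩
  ext z
  rw [bergmanShift_apply, bergmanInclusion_apply, bergmanInclusion_apply, hm', hf,
    bergmanShift_apply, map_smul]

/-- The operator `f ↦ Θ f` from `A_n(U)` onto `M`. -/
theorem exists_lift_operator (hL : IsLiftedRange ev hΘ) (hev : Function.Injective ev) :
    ∃ T : BergmanSpace n U →L[ℂ] M,
      (∀ f z, ev (T f) z = Θ z (f z)) ∧ ∀ f, ‖T f‖ ≤ ‖f‖ := by
  choose T hT using hL.exists_lift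
  have hle : ∀ f, ‖T f‖ ≤ ‖f‖ := fun f => by
    rw [hL.norm_eq (T f) f (hT f)]
    exact Submodule.norm_starProjection_apply_le _ f
  exact ⟨LinearMap.mkContinuous
    { toFun := T
      map_add' := fun f g => hev (funext fun z => by simp [hT])
      map_smul' := fun c f => hev (funext fun z => by simp [hT]) }
    1 fun f => by rw [one_mul]; exact hle f, hT, hle⟩

variable [CompleteSpace M]

/-- The map is `T^*` for `T : f ↦ Θ f`. Since `T` is contractive, so is `T^*`; norm-attaining
representatives give the reverse bound. The intertwining is the adjoint of `S_n|_M T = T S_n`, which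
holds because `Θ(z)` commutes with the scalar `z`. -/
theorem exists_isometry_intertwine (hL : IsLiftedRange ev hΘ) (hev : Function.Injective ev)
    (h₁ : IsContractivelyIncluded n ev) (h₂ : IsShiftInvariant h₁) :
    ∃ V : M →L[ℂ] BergmanSpace n U, (∀ m, ‖V m‖ = ‖m‖) ∧
      V ∘L (shiftRestriction hev h₁ h₂).adjoint = (bergmanShift n U).adjoint ∘L V := by
  obtain ⟨T, hT, hle⟩ := hL.exists_lift_operator hev
  refine ⟨T.adjoint, fun m => le_antisymm ?_ ?_, ?_⟩
  · have h : ‖T.adjoint‖ ≤ 1 := by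
      rw [LinearIsometryEquiv.norm_map]
      exact T.opNorm_le_bound zero_le_one fun f => by rw [one_mul]; exact hle f
    simpa using T.adjoint.le_of_opNorm_le h m
  · obtain ⟨f, hf, hfm⟩ := hL.exists_norm_eq m
    have hTf : T f = m := hev (funext fun z => by rw [hT, hf])
    rcases eq_or_ne m 0 with rfl | hm
    · simp
    refine le_of_mul_le_mul_left ?_ (norm_pos_iff.2 hm)
    -- With `T f = m` and `‖f‖ = ‖m‖`, Cauchy–Schwarz bounds `‖m‖²` by `‖m‖ ‖T^* m‖`.
    calc ‖m‖ * ‖m‖ = ‖inner ℂ (T f) m‖ := by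
          rw [hTf, inner_self_eq_norm_sq_to_K, norm_pow, sq]; simp
      _ = ‖inner ℂ f (T.adjoint m)‖ := by rw [ContinuousLinearMap.adjoint_inner_right]
      _ ≤ ‖f‖ * ‖T.adjoint m‖ := norm_inner_le_norm _ _
      _ = ‖m‖ * ‖T.adjoint m‖ := by rw [hfm]
  · rw [← ContinuousLinearMap.adjoint_comp, ← ContinuousLinearMap.adjoint_comp]
    congr 1
    ext1 f
    refine bergmanInclusion_injective hev h₁ ?_
    rw [ContinuousLinearMap.comp_apply, ContinuousLinearMap.comp_apply, inclusion_shiftRestriction]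
    ext z
    rw [bergmanShift_apply, bergmanInclusion_apply, bergmanInclusion_apply, hT, hT,
      bergmanShift_apply, map_smul]

end IsLiftedRange

end

theorem theorem6p3 {M : Type u} {Y : Type v}
    [NormedAddCommGroup M] [InnerProductSpace ℂ M] [CompleteSpace M]
    [NormedAddCommGroup Y] [InnerProductSpace ℂ Y] [CompleteSpace Y]
    (n : ℕ) (hn : 1 ≤ n) (ev : M →ₗ[ℂ] (𝔻 → Y)) (hev : Function.Injective ev) :
    (∃ (h₁ : IsContractivelyIncluded n ev) (h₂ : IsShiftInvariant h₁),
      IsStronglyStable (shiftRestriction hev h₁ h₂).adjoint ∧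
      IsHypercontraction n (shiftRestriction hev h₁ h₂).adjoint) ↔
    (∃ (U : Type u) (_ : NormedAddCommGroup U) (_ : InnerProductSpace ℂ U)
      (_ : CompleteSpace U) (Θ : 𝔻 → (U →L[ℂ] Y)) (hΘ : IsContractiveMultiplier n Θ),
      IsLiftedRange ev hΘ) := by
  constructor
  · rintro ⟨h₁, h₂, hs, hA⟩
    exact ⟨M, inferInstance, inferInstance, inferInstance,
      exists_isLiftedRange hn hev h₁ h₂ hs hA⟩
  · rintro ⟨U, _, _, _, Θ, hΘ, hL⟩
    have h₁ := hL.isContractivelyIncluded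
    have h₂ := hL.isShiftInvariant h₁
    obtain ⟨V, hV, hVA⟩ := hL.exists_isometry_intertwine hev h₁ h₂
    exact ⟨h₁, h₂,
      (BergmanSpace.isStronglyStable_shift_adjoint hn).of_intertwine hV hVA,
      (BergmanSpace.isHypercontraction_shift_adjoint hn).of_intertwine hV hVA⟩
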